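/- Let $\mathcal Q$ be a set, $(\mathcal Y,\Sigma)$ a measurable space, $Y$ a $\mathcal Y$-valued random variable, $\mathfrak c\colon\mathcal Y\times\mathcal Q\to\mathbb R$ a cost function with $y\mapsto\mathfrak c(y,q)$ measurable for every $q\in\mathcal Q$, and $\mathfrak l\colon\mathcal Q\times\mathcal Q\to[0,\infty)$ a loss function. Let $n\ge 1$ be an integer and let $Y_1,\dots,Y_n$ be independent copies of $Y$. Put $F(q)=\mathbb E[\mathfrak c(Y,q)]$ and $F_n(q)=\frac1n\sum_{i=1}^n\mathfrak c(Y_i,q)$. For $A\subset\mathcal Q$, a pseudo-metric $\mathfrak b$ on $\mathcal Q$ and $r>0$, let $N(A,\mathfrak b,r)$ be the smallest $k$ such that $A$ is covered by $k$ closed $\mathfrak b$-balls of radius $r$ with centers in $\mathcal Q$ ($\infty$ if there is none), and let $B_\delta(m,\mathfrak l)=\{q\in\mathcal Q:\mathfrak l(m,q)\le\delta\}$. Assume: 1. (Existence) $\mathbb E|\mathfrak c(Y,q)|<\infty$ for all $q\in\mathcal Q$; $m\in\mathcal Q$ minimizes $F$ over $\mathcal Q$; and $m_n$ is a $\mathcal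 Q$-valued random element that almost surely minimizes $F_n$ over $\mathcal Q$. 2. (Growth) There are $\gamma>0$, $c_g>0$ with $F(q)-F(m)\ge c_g\,\mathfrak l(m,q)^\gamma$ for all $q\in\mathcal Q$. 3. (Weak quadruple inequality) There are a measurable $\mathfrak a\colon\mathcal Y\times\mathcal Y\to[0,\infty)$ and a pseudo-metric $\mathfrak b$ on $\mathcal Q$ with $\mathfrak c(y,q)-\mathfrak c(z,q)-\mathfrak c(y,p)+\mathfrak c(z,p)\le\mathfrak a(y,z)\,\mathfrak b(q,p)$ for all $p,q\in\mathcal Q$, $y,z\in\mathcal Y$. 4. (Moment) For some $\zeta\ge1$, $\mathfrak M(\zeta)<\infty$, where $\mathfrak M(\zeta)=\mathbb E[\mathfrak a(Y',Y)^\zeta]$ if $\zeta\ge2$ and $\mathfrak M(\zeta)=\mathbb E[\mathfrak a(Y',Y)^2]^{\zeta/2}$ if $\zeta\le2$, with $Y'$ an independent copy of $Y$. 5. (Entropy) There are $\alpha,\beta>0$ with $\frac\alpha\beta<\gamma$ and $c_e>0$ such that $\sqrt{\log N(B_\delta(m,\mathfrak l),\mathfrak b,r)}\le c_e\,\delta^\alpha/r^\beta$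 for all $\delta,r>0$ (in particular these covering numbers are finite). Let $\eta_{\beta,n}=n^{-1/2}$ if $\beta<1$, $\eta_{\beta,n}=n^{-1/2}\log(n+1)$ if $\beta=1$, and $\eta_{\beta,n}=n^{-1/(2\beta)}$ if $\beta>1$. Then, for all $t>0$, $$\mathbb P\Big(\eta_{\beta,n}^{-\frac{1}{\gamma-\alpha/\beta}}\,\mathfrak l(m,m_n)\ge t\Big)\le c\,\mathfrak M(\zeta)\,t^{-\zeta(\gamma-\frac\alpha\beta)},$$ where $c>0$ depends only on $\alpha,\beta,\gamma,c_e,c_g,\zeta$. (If $m_n$ is not measurable, the same bound holds with $\mathbb P$ read as outer probability.) -/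

import Mathlib

open MeasureTheory ProbabilityTheory
open scoped ENNReal NNReal

noncomputable section

/-- The objective function `F(q) = E[c(Y, q)]`, where `P` is the law of `Y`. -/
def objective {𝓨 𝓠 : Type*} [MeasurableSpace 𝓨] (P : Measure 𝓨) (c : 𝓨 → 𝓠 → ℝ) (q : 𝓠) : ℝ :=
  ∫ y, c y q ∂P

/-- The empirical objective function `F_n(q) = (1/n) ∑ i, c(y_i, q)` of a sample `y_1, …, y_n`. -/
def empObjective {𝓨 𝓠 : Type*} {n : ℕ} (c : 𝓨 → 𝓠 → ℝ) (y : Fin n → 𝓨) (q : 𝓠) : ℝ :=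
  (1 / (n : ℝ)) * ∑ i, c (y i) q

/-- The set of all global minimizers of a real function. -/
def argminSet {𝓠 : Type*} (G : 𝓠 → ℝ) : Set 𝓠 :=
  {q | ∀ p, G q ≤ G p}

/-- The closed ball of radius `δ` around `o` for an arbitrary distance function `d`. -/
def lossBall {𝓠 : Type*} (d : 𝓠 → 𝓠 → ℝ) (o : 𝓠) (δ : ℝ) : Set 𝓠 :=
  {q | d o q ≤ δ}

/-- The moment `M(ζ)`, which is `E[a(Y', Y)^ζ]` for `ζ ≥ 2` and `E[a(Y', Y)^2]^(ζ/2)` for `ζ ≤ 2`,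
with `Y'`, `Y` independent of law `P`; an extended nonnegative number. -/
def dataMoment {𝓨 : Type*} [MeasurableSpace 𝓨] (P : Measure 𝓨) (a : 𝓨 → 𝓨 → ℝ) (ζ : ℝ) : ℝ≥0∞ :=
  if 2 ≤ ζ then ∫⁻ z, ENNReal.ofReal (a z.1 z.2 ^ ζ) ∂(P.prod P)
  else (∫⁻ z, ENNReal.ofReal (a z.1 z.2 ^ 2) ∂(P.prod P)) ^ (ζ / 2)

/-- The rate `η_{β,n}`. -/
def rateEta (β : ℝ) (n : ℕ) : ℝ :=
  if β < 1 then (n : ℝ) ^ (-(1 / 2) : ℝ)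
  else if β = 1 then (n : ℝ) ^ (-(1 / 2) : ℝ) * Real.log ((n : ℝ) + 1)
  else (n : ℝ) ^ (-(1 / (2 * β)) : ℝ)

end

/-!
The proof is a peeling argument on top of a deviation inequality for the centred empirical
increments `G(y, q) = F_n(q) - F_n(m) - (F(q) - F(m))` on a ball `B_δ(m)` of the loss.

If `q = m_n` minimizes `F_n`, then `c_g * l(m, q) ^ γ ≤ F(q) - F(m) ≤ -G(q)`
(`le_abs_empIncrement_of_mem_argminSet`). On the dyadic shell `2 ^ j * τ ≤ l(m, q) < 2 ^ (j + 1) * τ`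
the supremum of `|G|` over a ball of radius `δ = 2 ^ (j + 1) * τ` is therefore at least of order
`δ ^ γ`, whereas its `L^ζ`-norm is only of order `η * δ ^ (α / β)`
(`exists_measure_lossBall_le`). Markov's inequality bounds the probability of each shell, and since
`α / β < γ` the bounds sum to a geometric series.

The bound on the supremum comes from symmetrization. `G(y, q)` is the mean, over an independent
copy `y'` of the sample, of the average of the quadruple differences
`c(y_i, q) - c(y'_i, q) - c(y_i, m) + c(y'_i, m)`. The law of the pairs `(y_i, y'_i)` is invariant
under exchanging the entries of any of the pairs, which changes the sign of the corresponding
difference. So, with the pairs fixed, one may average over random signs, and the process becomes a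
Rademacher process on a finite sign space whose increments are controlled by `a(y_i, y'_i)` times
the metric. A maximal inequality for finitely many such sums (`sum_signs_sup_rpow_le`) and chaining
over finite nets (`sum_signs_chaining_le`) give the entropy bound with the random factor
`√(∑ a(y_i, y'_i) ^ 2)`, whose moment is the data moment (`lintegral_sqrt_sum_sq_rpow_le`).

The chain is stopped at a finite level, the Lipschitz bound accounting for the distance to the
finest net. This avoids all measurability questions about uncountable suprema, and the choice of
the level produces the three regimes of the rate `η` (`exists_depth`).
-/

/-! ### Random signs and chaining -/

/-- The sign `1` or `-1` encoded by a Boolean. -/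
def boolSign (b : Bool) : ℝ := if b then 1 else -1

theorem sum_exp_boolSign_le {n : ℕ} (v : Fin n → ℝ) :
    ∑ ε : Fin n → Bool, Real.exp (∑ i, boolSign (ε i) * v i) ≤
      2 ^ n * Real.exp ((∑ i, v i ^ 2) / 2) := by
  have h := Finset.prod_univ_sum (fun _ : Fin n => (Finset.univ : Finset Bool))
    (fun i b => Real.exp (boolSign b * v i))
  rw [Fintype.piFinset_univ] at h
  simp_rw [Real.exp_sum]
  rw [← h, Finset.sum_div, Real.exp_sum]
  have h2 : (2 : ℝ) ^ n = ∏ _i : Fin n, 2 := by simp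
  rw [h2, ← Finset.prod_mul_distrib]
  refine Finset.prod_le_prod (fun i _ => Finset.sum_nonneg fun b _ => (Real.exp_pos _).le) ?_
  intro i _
  have := Real.cosh_le_exp_half_sq (v i)
  rw [Real.cosh_eq] at this
  simp only [Fintype.sum_bool, boolSign, if_true, Bool.false_eq_true, if_false, one_mul, neg_mul]
  linarith

theorem rpow_le_mul_exp {ζ x : ℝ} (hζ : 1 ≤ ζ) (hx : 0 ≤ x) : x ^ ζ ≤ ζ ^ ζ * Real.exp x := by
  have hζ0 : 0 < ζ := by linarith
  have h1 : x / ζ ≤ Real.exp (x / ζ) := by linarith [Real.add_one_le_exp (x / ζ)]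
  have h2 := Real.rpow_le_rpow (by positivity) h1 hζ0.le
  rw [← Real.exp_mul, div_mul_cancel₀ _ hζ0.ne', Real.div_rpow hx hζ0.le,
    div_le_iff₀ (by positivity)] at h2
  linarith

/-- The constant of the maximal inequality for Rademacher sums in `L^ζ`. -/
noncomputable def maxConst (ζ : ℝ) : ℝ := ζ ^ ζ * (3 * Real.exp (3 / 2))

theorem maxConst_pos {ζ : ℝ} (hζ : 1 ≤ ζ) : 0 < maxConst ζ := by
  unfold maxConst; positivity

/-- Maximal inequality: the maximum of finitely many Rademacher sums, each of variance at most
`σ ^ 2`, is of order `σ * √(1 + log #T)` in `L^ζ`. -/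
theorem sum_signs_sup_rpow_le {κ : Type*} {n : ℕ} {ζ : ℝ} (hζ : 1 ≤ ζ) (T : Finset κ)
    (hT : T.Nonempty) (x : κ → Fin n → ℝ) {σ : ℝ} (hσ : 0 ≤ σ)
    (hx : ∀ p ∈ T, ∑ i, x p i ^ 2 ≤ σ ^ 2) :
    ∑ ε : Fin n → Bool, ((T.sup fun p => ‖∑ i, boolSign (ε i) * x p i‖₊ : ℝ≥0) : ℝ) ^ ζ ≤
      2 ^ n * (maxConst ζ * (σ * √(1 + Real.log T.card)) ^ ζ) := by
  have hζ0 : 0 < ζ := by linarith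
  set Z : (Fin n → Bool) → ℝ :=
    fun ε => ((T.sup fun p => ‖∑ i, boolSign (ε i) * x p i‖₊ : ℝ≥0) : ℝ) with hZ
  have hZ0 : ∀ ε, 0 ≤ Z ε := fun ε => NNReal.coe_nonneg _
  have hZe : ∀ ε, ∃ p ∈ T, Z ε = |∑ i, boolSign (ε i) * x p i| := by
    intro ε
    obtain ⟨p, hp, h⟩ := Finset.exists_mem_eq_sup T hT fun p => ‖∑ i, boolSign (ε i) * x p i‖₊
    exact ⟨p, hp, by simp only [hZ]; rw [h]; simp⟩
  change ∑ ε, Z ε ^ ζ ≤ _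
  have hcard : (1 : ℝ) ≤ T.card := by exact_mod_cast hT.card_pos
  rcases hσ.eq_or_lt with rfl | hσ
  · have h0 : ∀ ε, Z ε = 0 := by
      intro ε
      obtain ⟨p, hp, h⟩ := hZe ε
      have h1 := hx p hp
      have h2 : ∑ i, x p i ^ 2 = 0 :=
        le_antisymm (by simpa using h1) (Finset.sum_nonneg fun i _ => sq_nonneg _)
      rw [Finset.sum_eq_zero_iff_of_nonneg fun i _ => sq_nonneg _] at h2
      rw [h, Finset.sum_eq_zero, abs_zero]
      intro i hi
      have := h2 i hi
      rw [pow_eq_zero_iff two_ne_zero] at this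
      rw [this, mul_zero]
    simp [h0, Real.zero_rpow hζ0.ne']
  set L := √(1 + Real.log T.card) with hL
  have hlog := Real.log_nonneg hcard
  have hL2 : L ^ 2 = 1 + Real.log T.card := Real.sq_sqrt (by linarith)
  have hL1 : 1 ≤ L := Real.one_le_sqrt.mpr (by linarith)
  have hL0 : 0 < L := by linarith
  have hTL : (T.card : ℝ) ≤ Real.exp (L ^ 2) := by
    rw [hL2, Real.exp_add, Real.exp_log (by linarith)]
    nlinarith [Real.add_one_le_exp (1 : ℝ)]
  -- the parameter `L / σ` makes both `#T` and the exponential moment of a single sum of order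
  -- `exp (O(L ^ 2))`
  have hexp : ∑ ε, Real.exp (L / σ * Z ε) ≤ 2 ^ n * (2 * Real.exp (3 / 2 * L ^ 2)) := by
    calc ∑ ε, Real.exp (L / σ * Z ε)
        ≤ ∑ ε : Fin n → Bool, ∑ p ∈ T, (Real.exp (∑ i, boolSign (ε i) * (L / σ * x p i)) +
            Real.exp (∑ i, boolSign (ε i) * (-(L / σ) * x p i))) := by
          refine Finset.sum_le_sum fun ε _ => ?_
          obtain ⟨p, hp, h⟩ := hZe ε
          refine le_trans ?_ (Finset.single_le_sum
            (f := fun p => Real.exp (∑ i, boolSign (ε i) * (L / σ * x p i)) +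
              Real.exp (∑ i, boolSign (ε i) * (-(L / σ) * x p i)))
            (fun q _ => by positivity) hp)
          have e1 : ∑ i, boolSign (ε i) * (L / σ * x p i) =
              L / σ * ∑ i, boolSign (ε i) * x p i := by
            rw [Finset.mul_sum]; exact Finset.sum_congr rfl fun i _ => by ring
          have e2 : ∑ i, boolSign (ε i) * (-(L / σ) * x p i) =
              L / σ * -∑ i, boolSign (ε i) * x p i := by
            rw [mul_neg, Finset.mul_sum, ← Finset.sum_neg_distrib]
            exact Finset.sum_congr rfl fun i _ => by ring
          rw [e1, e2, h]
          rcases abs_choice (∑ i, boolSign (ε i) * x p i) with h' | h' <;> rw [h']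
          · linarith [Real.exp_pos (L / σ * -∑ i, boolSign (ε i) * x p i)]
          · linarith [Real.exp_pos (L / σ * ∑ i, boolSign (ε i) * x p i)]
      _ = ∑ p ∈ T, (∑ ε : Fin n → Bool, Real.exp (∑ i, boolSign (ε i) * (L / σ * x p i)) +
            ∑ ε : Fin n → Bool, Real.exp (∑ i, boolSign (ε i) * (-(L / σ) * x p i))) := by
          rw [Finset.sum_comm]
          exact Finset.sum_congr rfl fun p _ => Finset.sum_add_distrib
      _ ≤ ∑ p ∈ T, (2 ^ n * (2 * Real.exp (L ^ 2 / 2))) := by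
          refine Finset.sum_le_sum fun p hp => ?_
          have hb : (∑ i, (L / σ * x p i) ^ 2) / 2 ≤ L ^ 2 / 2 := by
            simp_rw [mul_pow]
            rw [← Finset.mul_sum]
            have : (L / σ) ^ 2 * ∑ i, x p i ^ 2 ≤ (L / σ) ^ 2 * σ ^ 2 :=
              mul_le_mul_of_nonneg_left (hx p hp) (sq_nonneg _)
            rw [← mul_pow, div_mul_cancel₀ _ hσ.ne'] at this
            linarith
          have b1 := sum_exp_boolSign_le fun i => L / σ * x p i
          have b2 := sum_exp_boolSign_le fun i => -(L / σ) * x p i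
          have b3 : ∀ i, (-(L / σ) * x p i) ^ 2 = (L / σ * x p i) ^ 2 := fun i => by ring
          simp_rw [b3] at b2
          have b4 : (2 : ℝ) ^ n * Real.exp ((∑ i, (L / σ * x p i) ^ 2) / 2) ≤
              2 ^ n * Real.exp (L ^ 2 / 2) := by gcongr
          linarith
      _ = T.card * (2 ^ n * (2 * Real.exp (L ^ 2 / 2))) := by simp
      _ ≤ Real.exp (L ^ 2) * (2 ^ n * (2 * Real.exp (L ^ 2 / 2))) := by gcongr
      _ = 2 ^ n * (2 * Real.exp (3 / 2 * L ^ 2)) := by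
          rw [show 3 / 2 * L ^ 2 = L ^ 2 + L ^ 2 / 2 by ring, Real.exp_add]; ring
  have hpt : ∀ ε, Z ε ^ ζ ≤ (σ * L) ^ ζ * (ζ ^ ζ * (Real.exp (3 / 2) *
      (1 + Real.exp (L / σ * Z ε) / Real.exp (3 / 2 * L ^ 2)))) := by
    intro ε
    set u := Z ε / (σ * L) with hu
    have hZu : Z ε = σ * L * u := by rw [hu]; field_simp
    have hu0 : 0 ≤ u := div_nonneg (hZ0 ε) (by positivity)
    have hlu : L / σ * Z ε = L ^ 2 * u := by rw [hZu]; field_simp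
    rw [hlu, hZu, Real.mul_rpow (by positivity) hu0, ← Real.exp_sub]
    refine mul_le_mul_of_nonneg_left ?_ (by positivity)
    refine (rpow_le_mul_exp hζ hu0).trans (mul_le_mul_of_nonneg_left ?_ (by positivity))
    rw [show u = 3 / 2 + (u - 3 / 2) by ring, Real.exp_add]
    refine mul_le_mul_of_nonneg_left ?_ (by positivity)
    rw [show 3 / 2 + (u - 3 / 2) = u by ring]
    -- beyond `3 / 2` the factor `L ^ 2 ≥ 1` only helps
    rcases le_total u (3 / 2) with h | h
    · have : Real.exp (u - 3 / 2) ≤ 1 := Real.exp_le_one_iff.mpr (by linarith)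
      linarith [Real.exp_pos (L ^ 2 * u - 3 / 2 * L ^ 2)]
    · have : Real.exp (u - 3 / 2) ≤ Real.exp (L ^ 2 * u - 3 / 2 * L ^ 2) := by
        apply Real.exp_le_exp.mpr
        have : 1 ≤ L ^ 2 := by nlinarith
        nlinarith
      linarith
  calc ∑ ε, Z ε ^ ζ ≤ ∑ ε : Fin n → Bool, (σ * L) ^ ζ * (ζ ^ ζ * (Real.exp (3 / 2) *
        (1 + Real.exp (L / σ * Z ε) / Real.exp (3 / 2 * L ^ 2)))) :=
        Finset.sum_le_sum fun ε _ => hpt ε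
    _ = (σ * L) ^ ζ * (ζ ^ ζ * (Real.exp (3 / 2) *
        (2 ^ n + (∑ ε, Real.exp (L / σ * Z ε)) / Real.exp (3 / 2 * L ^ 2)))) := by
        rw [← Finset.mul_sum, ← Finset.mul_sum, ← Finset.mul_sum, Finset.sum_add_distrib,
          Finset.sum_div]
        simp
    _ ≤ (σ * L) ^ ζ * (ζ ^ ζ * (Real.exp (3 / 2) * (2 ^ n + 2 ^ n * 2))) := by
        gcongr
        rw [div_le_iff₀ (Real.exp_pos _)]
        linarith
    _ = _ := by unfold maxConst; ring

/-- Chaining along a finite sequence of nets `T 0 = {m}, T 1, …, T K`: links between consecutive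
levels are controlled by the maximal inequality, and their contributions are added by convexity
of `x ↦ x ^ ζ` with weights proportional to `r k * √(1 + log #(T (k + 1)))`. -/
theorem sum_signs_chaining_le {𝓠 : Type*} [PseudoMetricSpace 𝓠] {n : ℕ} {ζ : ℝ} (hζ : 1 ≤ ζ)
    (T : ℕ → Finset 𝓠) (m : 𝓠) (hT0 : T 0 = {m}) (hT : ∀ k, (T k).Nonempty) (r : ℕ → ℝ)
    (hr : ∀ k, 0 < r k) (hnet : ∀ k, ∀ p ∈ T (k + 1), ∃ p' ∈ T k, dist p p' ≤ r k)
    (x : 𝓠 → Fin n → ℝ) (hxm : ∀ i, x m i = 0) (a : Fin n → ℝ)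
    (hx : ∀ p q i, |x p i - x q i| ≤ a i * dist p q) {σ : ℝ} (hσ : 0 ≤ σ)
    (ha : ∑ i, a i ^ 2 ≤ σ ^ 2) {K : ℕ} (hK : 1 ≤ K) :
    ∑ ε : Fin n → Bool, (((T K).sup fun p => ‖∑ i, boolSign (ε i) * x p i‖₊ : ℝ≥0) : ℝ) ^ ζ ≤
      2 ^ n * (maxConst ζ *
        (σ * ∑ k ∈ Finset.range K, r k * √(1 + Real.log (T (k + 1)).card)) ^ ζ) := by
  classical
  have hζ0 : 0 < ζ := by linarith
  choose! π hπ hπd using hnet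
  set S : (Fin n → Bool) → 𝓠 → ℝ := fun ε p => ∑ i, boolSign (ε i) * x p i with hS
  set M : ℕ → (Fin n → Bool) → ℝ≥0 := fun k ε =>
    (T (k + 1)).sup fun p => ‖∑ i, boolSign (ε i) * (x p i - x (π k p) i)‖₊ with hM
  set w : ℕ → ℝ := fun k => r k * √(1 + Real.log (T (k + 1)).card) with hw
  have hw0 : ∀ k, 0 < w k := fun k => by
    have : (1 : ℝ) ≤ (T (k + 1)).card := by exact_mod_cast (hT (k + 1)).card_pos
    have := Real.log_nonneg this
    exact mul_pos (hr k) (Real.sqrt_pos.mpr (by linarith))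
  set W := ∑ k ∈ Finset.range K, w k with hW
  have hW0 : 0 < W := Finset.sum_pos (fun k _ => hw0 k) (by simpa using by omega)
  have htel : ∀ k ε, ((T k).sup fun p => ‖S ε p‖₊) ≤ ∑ j ∈ Finset.range k, M j ε := by
    intro k ε
    induction k with
    | zero => simp [hT0, hS, hxm]
    | succ k ih =>
      refine Finset.sup_le fun p hp => ?_
      rw [Finset.sum_range_succ]
      have e : S ε p = S ε (π k p) + ∑ i, boolSign (ε i) * (x p i - x (π k p) i) := by
        simp only [hS]; rw [← Finset.sum_add_distrib]
        exact Finset.sum_congr rfl fun i _ => by ring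
      rw [e]
      refine (nnnorm_add_le _ _).trans (add_le_add (le_trans ?_ ih) ?_)
      · exact Finset.le_sup (f := fun p => ‖S ε p‖₊) (hπ k p hp)
      · exact Finset.le_sup
          (f := fun p => ‖∑ i, boolSign (ε i) * (x p i - x (π k p) i)‖₊) hp
  have hlink : ∀ k, ∑ ε : Fin n → Bool, (M k ε : ℝ) ^ ζ ≤
      2 ^ n * (maxConst ζ * (σ * w k) ^ ζ) := by
    intro k
    have := sum_signs_sup_rpow_le hζ (T (k + 1)) (hT _) (fun p i => x p i - x (π k p) i)
      (σ := σ * r k) (mul_nonneg hσ (hr k).le) ?_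
    · simpa only [hM, hw, mul_assoc] using this
    · intro p hp
      calc ∑ i, (x p i - x (π k p) i) ^ 2 ≤ ∑ i, a i ^ 2 * r k ^ 2 := by
            refine Finset.sum_le_sum fun i _ => ?_
            rw [← sq_abs, ← mul_pow]
            have h1 := hx p (π k p) i
            have h2 : 0 ≤ a i * dist p (π k p) := (abs_nonneg _).trans h1
            have h3 : (a i * dist p (π k p)) ^ 2 ≤ (a i * r k) ^ 2 := by
              rw [mul_pow, mul_pow]
              gcongr
              exact hπd k p hp
            exact (pow_le_pow_left₀ (abs_nonneg _) h1 2).trans h3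
        _ ≤ (σ * r k) ^ 2 := by
            rw [← Finset.sum_mul, mul_pow]; gcongr
  have hpt : ∀ ε, (((T K).sup fun p => ‖S ε p‖₊ : ℝ≥0) : ℝ) ^ ζ ≤
      ∑ k ∈ Finset.range K, W ^ ζ * (w k / W * ((M k ε : ℝ) ^ ζ / w k ^ ζ)) := by
    intro ε
    have h1 : (((T K).sup fun p => ‖S ε p‖₊ : ℝ≥0) : ℝ) ≤
        ∑ k ∈ Finset.range K, (M k ε : ℝ) := by exact_mod_cast htel K ε
    have h2 := Real.rpow_arith_mean_le_arith_mean_rpow (Finset.range K) (fun k => w k / W)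
      (fun k => M k ε / w k) (fun k _ => (div_pos (hw0 k) hW0).le)
      (by rw [← Finset.sum_div, div_self hW0.ne'])
      (fun k _ => div_nonneg (NNReal.coe_nonneg _) (hw0 k).le) hζ
    have h3 : ∑ k ∈ Finset.range K, w k / W * (M k ε / w k) =
        (∑ k ∈ Finset.range K, (M k ε : ℝ)) / W := by
      rw [Finset.sum_div]
      refine Finset.sum_congr rfl fun k _ => ?_
      have := (hw0 k).ne'
      field_simp
    rw [h3, Real.div_rpow (Finset.sum_nonneg fun k _ => NNReal.coe_nonneg _) hW0.le,
      div_le_iff₀ (by positivity)] at h2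
    refine (Real.rpow_le_rpow (NNReal.coe_nonneg _) h1 hζ0.le).trans (h2.trans_eq ?_)
    rw [mul_comm, Finset.mul_sum]
    refine Finset.sum_congr rfl fun k _ => ?_
    rw [Real.div_rpow (NNReal.coe_nonneg _) (hw0 k).le]
  calc ∑ ε, (((T K).sup fun p => ‖S ε p‖₊ : ℝ≥0) : ℝ) ^ ζ
      ≤ ∑ ε, ∑ k ∈ Finset.range K, W ^ ζ * (w k / W * ((M k ε : ℝ) ^ ζ / w k ^ ζ)) :=
        Finset.sum_le_sum fun ε _ => hpt ε
    _ = ∑ k ∈ Finset.range K, W ^ ζ * (w k / W * ((∑ ε, (M k ε : ℝ) ^ ζ) / w k ^ ζ)) := by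
        rw [Finset.sum_comm]
        refine Finset.sum_congr rfl fun k _ => ?_
        rw [← Finset.mul_sum, ← Finset.mul_sum, Finset.sum_div]
    _ ≤ ∑ k ∈ Finset.range K, W ^ ζ * (w k / W * (2 ^ n * (maxConst ζ * σ ^ ζ))) := by
        refine Finset.sum_le_sum fun k _ => ?_
        have := (hw0 k)
        gcongr
        rw [div_le_iff₀ (by positivity)]
        refine (hlink k).trans_eq ?_
        rw [Real.mul_rpow hσ (hw0 k).le]; ring
    _ = 2 ^ n * (maxConst ζ * (σ * W) ^ ζ) := by
        rw [← Finset.mul_sum, ← Finset.sum_mul, ← Finset.sum_div, div_self hW0.ne',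
          Real.mul_rpow hσ hW0.le]
        ring

/-! ### Nets and the choice of the chaining depth -/

/-- Nets of geometrically decreasing radii `2 * ρ * D / 2 ^ k` for a set whose entropy is of
polynomial growth. The factor `ρ = (2 * ce) ^ (1 / β)` makes the covering number at the coarsest
scale smaller than `2`, so that the coarsest net can be replaced by any point of the set. -/
theorem exists_nets {𝓠 : Type*} [PseudoMetricSpace 𝓠] {B : Set 𝓠} {m : 𝓠} (hm : m ∈ B)
    {D ce β ρ : ℝ} (hD : 0 < D) (hρ : 0 < ρ) (hρβ : ρ ^ β = 2 * ce)
    (hce : 0 < ce)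
    (hB : ∀ r : ℝ≥0, 0 < r → Metric.externalCoveringNumber r B ≠ ⊤ ∧
      √(Real.log (Metric.externalCoveringNumber r B).toNat) ≤ ce * (D / r) ^ β) :
    ∃ T : ℕ → Finset 𝓠, T 0 = {m} ∧ (∀ k, (T k).Nonempty) ∧ (∀ k, ↑(T k) ⊆ B) ∧
      (∀ k, ∀ q ∈ B, ∃ p ∈ T k, dist q p ≤ 2 * ρ * D / 2 ^ k) ∧
      ∀ k, √(Real.log (T k).card) ≤ (2 ^ β) ^ k / 2 := by
  classical
  have key : ∀ k : ℕ, ∃ C : Finset 𝓠, C.Nonempty ∧ ↑C ⊆ B ∧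
      (∀ q ∈ B, ∃ p ∈ C, dist q p ≤ 2 * ρ * D / 2 ^ k) ∧
      √(Real.log C.card) ≤ (2 ^ β) ^ k / 2 := by
    intro k
    have hr : 0 < ρ * D / 2 ^ k := by positivity
    set r : ℝ≥0 := ⟨ρ * D / 2 ^ k, hr.le⟩ with hrdef
    have hrc : (r : ℝ) = ρ * D / 2 ^ k := rfl
    obtain ⟨hfin, hle⟩ := hB r (NNReal.coe_pos.mp (by rw [hrc]; exact hr))
    have hcov := Metric.coveringNumber_two_mul_le_externalCoveringNumber r B
    obtain ⟨C, hCB, hCf, hC, hcard⟩ := Metric.exists_set_encard_eq_coveringNumber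
      (ne_top_of_le_ne_top hfin hcov)
    have hne : C.Nonempty := hC.nonempty ⟨m, hm⟩
    refine ⟨hCf.toFinset, by simpa using hne, by simpa using hCB, ?_, ?_⟩
    · intro q hq
      obtain ⟨p, hp, hqp⟩ := hC hq
      refine ⟨p, by simpa using hp, ?_⟩
      have hqp' : edist q p ≤ ((2 * r : ℝ≥0) : ℝ≥0∞) := hqp
      rw [edist_nndist, ENNReal.coe_le_coe] at hqp'
      have : dist q p ≤ 2 * (r : ℝ) := by exact_mod_cast hqp'
      rw [hrc] at this
      refine this.trans_eq (by ring)
    · have h1 : ce * (D / r) ^ β = (2 ^ β) ^ k / 2 := by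
        have : D / (r : ℝ) = 2 ^ k / ρ := by rw [hrc]; field_simp
        rw [this, Real.div_rpow (by positivity) hρ.le, hρβ, ← Real.rpow_natCast 2 k,
          ← Real.rpow_natCast, ← Real.rpow_mul (by norm_num), ← Real.rpow_mul (by norm_num),
          mul_comm β]
        field_simp
      rw [← h1]
      refine le_trans (Real.sqrt_le_sqrt (Real.log_le_log ?_ ?_)) hle
      · have : 0 < hCf.toFinset.card := Finset.card_pos.mpr (by simpa using hne)
        exact_mod_cast this
      · rw [← hcard, hCf.encard_eq_coe_toFinset_card, ← ENat.natCast_toNat hfin] at hcov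
        exact_mod_cast hcov
  choose C hCne hCB hCc hCs using key
  refine ⟨fun k => if k = 0 then {m} else C k, by simp, ?_, ?_, ?_, ?_⟩
  · intro k; by_cases h : k = 0 <;> simp [h, hCne]
  · intro k
    by_cases h : k = 0
    · simpa [h] using hm
    · simpa [h] using hCB k
  · intro k q hq
    by_cases h : k = 0
    · subst h
      refine ⟨m, by simp, ?_⟩
      -- at the coarsest scale the external covering number is at most one
      have hr : 0 < ρ * D := by positivity
      set r : ℝ≥0 := ⟨ρ * D, hr.le⟩ with hrdef
      obtain ⟨hfin, hle⟩ := hB r (NNReal.coe_pos.mp hr)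
      set N := Metric.externalCoveringNumber r B with hN
      have h1 : ce * (D / (ρ * D)) ^ β = 1 / 2 := by
        rw [show D / (ρ * D) = 1 / ρ by field_simp, Real.div_rpow (by norm_num) hρ.le, hρβ,
          Real.one_rpow]
        field_simp
      change √(Real.log N.toNat) ≤ ce * (D / (ρ * D)) ^ β at hle
      rw [h1] at hle
      have hN1 : N.toNat ≤ 1 := by
        by_contra! h2
        have h3 : Real.log 2 ≤ Real.log N.toNat :=
          Real.log_le_log (by norm_num) (by exact_mod_cast h2)
        have h4 := Real.log_two_gt_d9
        have h5 : (1 / 2 : ℝ) < √(Real.log N.toNat) := by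
          apply Real.lt_sqrt_of_sq_lt; norm_num; linarith
        linarith
      have hNle : N ≤ 1 := by
        rw [← ENat.natCast_toNat hfin]; exact_mod_cast hN1
      obtain ⟨A, hA⟩ : ∃ A : Set 𝓠, Metric.IsCover r B A ∧ A.encard ≤ 1 := by
        by_contra! hcon
        have : (2 : ℕ∞) ≤ N := by
          refine le_iInf₂ fun A hA => ?_
          have := Order.add_one_le_of_lt (hcon A hA)
          exact (by norm_num : (1 : ℕ∞) + 1 = 2) ▸ this
        exact absurd (this.trans hNle) (by norm_num)
      obtain ⟨p, hp, hqp⟩ := hA.1 hq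
      obtain ⟨p', hp', hmp⟩ := hA.1 hm
      have hpp : p' = p := Set.encard_le_one_iff.mp hA.2 _ _ hp' hp
      subst hpp
      have e1 : edist q p' ≤ (r : ℝ≥0∞) := hqp
      have e2 : edist m p' ≤ (r : ℝ≥0∞) := hmp
      rw [edist_nndist, ENNReal.coe_le_coe] at e1 e2
      have e1' : dist q p' ≤ ρ * D := e1
      have e2' : dist m p' ≤ ρ * D := e2
      have := dist_triangle_right q m p'
      norm_num
      linarith
    · obtain ⟨p, hp, hd⟩ := hCc k q hq
      exact ⟨p, by simpa [h] using hp, hd⟩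
  · intro k
    by_cases h : k = 0
    · subst h; simp
    · simpa [h] using hCs k

/-- The sum of the chaining weights `r k * √(1 + log #(T (k + 1)))` is a geometric sum. -/
theorem sum_chaining_weights_le {R β : ℝ} (hR : 0 ≤ R) (hβ : 0 < β) (N : ℕ → ℝ)
    (hN1 : ∀ k, 1 ≤ N k) (hN : ∀ k, √(Real.log (N k)) ≤ (2 ^ β) ^ k / 2) (K : ℕ) :
    ∑ k ∈ Finset.range K, R / 2 ^ k * √(1 + Real.log (N (k + 1))) ≤
      R * (1 + 2 ^ β) * ∑ k ∈ Finset.range K, ((2 : ℝ) ^ (β - 1)) ^ k := by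
  rw [Finset.mul_sum]
  refine Finset.sum_le_sum fun k _ => ?_
  have h0 := Real.log_nonneg (hN1 (k + 1))
  have h1 : √(1 + Real.log (N (k + 1))) ≤ 1 + √(Real.log (N (k + 1))) := by
    rw [Real.sqrt_le_left (by positivity)]
    nlinarith [Real.sq_sqrt h0, Real.sqrt_nonneg (Real.log (N (k + 1)))]
  have h2 : (1 : ℝ) ≤ 2 ^ β := Real.one_le_rpow (by norm_num) hβ.le
  have h3 : (1 : ℝ) ≤ (2 ^ β) ^ k := one_le_pow₀ h2
  have h4 : √(1 + Real.log (N (k + 1))) ≤ (1 + 2 ^ β) * (2 ^ β) ^ k := by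
    have := hN (k + 1)
    rw [pow_succ] at this
    nlinarith
  calc R / 2 ^ k * √(1 + Real.log (N (k + 1))) ≤ R / 2 ^ k * ((1 + 2 ^ β) * (2 ^ β) ^ k) := by
        gcongr
    _ = R * (1 + 2 ^ β) * ((2 : ℝ) ^ (β - 1)) ^ k := by
        rw [Real.rpow_sub_one (by norm_num), div_pow]; ring

theorem rateEta_pos (β : ℝ) {n : ℕ} (hn : 1 ≤ n) : 0 < rateEta β n := by
  have hn0 : (0 : ℝ) < n := by exact_mod_cast hn
  have := Real.log_pos (show (1 : ℝ) < n + 1 by linarith)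
  unfold rateEta
  split_ifs <;> positivity

/-- The chaining depth: stopping the chain at a suitable level `K` balances the chaining sum
against the approximation error `2 ^ (-K)`, and the result is the rate `η`. -/
theorem exists_depth (β : ℝ) :
    ∃ C : ℝ, 0 < C ∧ ∀ n : ℕ, 1 ≤ n → ∃ K : ℕ, 1 ≤ K ∧
      (n : ℝ) ^ (-(1 / 2) : ℝ) * ∑ k ∈ Finset.range K, ((2 : ℝ) ^ (β - 1)) ^ k + 1 / 2 ^ K ≤
        C * rateEta β n := by
  have hmono : ∀ n : ℕ, 1 ≤ n → ∀ K : ℕ, n ≤ 2 ^ K →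
      (1 : ℝ) / 2 ^ K ≤ (n : ℝ) ^ (-(1 / 2) : ℝ) := by
    intro n hn K hK
    have hn1 : (1 : ℝ) ≤ n := by exact_mod_cast hn
    have hK' : (n : ℝ) ≤ 2 ^ K := by exact_mod_cast hK
    calc (1 : ℝ) / 2 ^ K ≤ 1 / n := by gcongr
      _ = (n : ℝ) ^ (-1 : ℝ) := by rw [Real.rpow_neg_one, one_div]
      _ ≤ _ := Real.rpow_le_rpow_of_exponent_le hn1 (by norm_num)
  rcases lt_trichotomy β 1 with hβ | hβ | hβ
  · have hq1 : (2 : ℝ) ^ (β - 1) < 1 := Real.rpow_lt_one_of_one_lt_of_neg (by norm_num) (by linarith)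
    have hq0 : (0 : ℝ) < 2 ^ (β - 1) := by positivity
    refine ⟨1 / (1 - 2 ^ (β - 1)) + 1, ?_, fun n hn => ⟨n, hn, ?_⟩⟩
    · have : 0 < 1 - (2 : ℝ) ^ (β - 1) := by linarith
      positivity
    · have h1 := hmono n hn n Nat.lt_two_pow_self.le
      have h2 : ∑ k ∈ Finset.range n, ((2 : ℝ) ^ (β - 1)) ^ k ≤ 1 / (1 - 2 ^ (β - 1)) := by
        rw [one_div, ← tsum_geometric_of_lt_one hq0.le hq1]
        exact (summable_geometric_of_lt_one hq0.le hq1).sum_le_tsum _ fun k _ => by positivity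
      have h3 : (0 : ℝ) ≤ (n : ℝ) ^ (-(1 / 2) : ℝ) := by positivity
      rw [rateEta, if_pos hβ]
      nlinarith
  · subst hβ
    have hl2 := Real.log_pos (show (1 : ℝ) < 2 by norm_num)
    refine ⟨3 / Real.log 2, by positivity, fun n hn => ⟨Nat.log 2 n + 1, by omega, ?_⟩⟩
    have h1 := hmono n hn _ (Nat.lt_pow_succ_log_self (b := 2) (by norm_num) n).le
    have hn1 : (1 : ℝ) ≤ n := by exact_mod_cast hn
    have h2 : (1 : ℝ) ≤ Real.log (n + 1) / Real.log 2 := by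
      rw [le_div_iff₀ hl2, one_mul]
      exact Real.log_le_log (by norm_num) (by linarith)
    have h3 : (Nat.log 2 n : ℝ) ≤ Real.log (n + 1) / Real.log 2 := by
      rw [le_div_iff₀ hl2, ← Real.log_pow]
      refine Real.log_le_log (by positivity) ?_
      have : 2 ^ Nat.log 2 n ≤ n := Nat.pow_log_le_self 2 (by omega)
      have : (2 : ℝ) ^ Nat.log 2 n ≤ n := by exact_mod_cast this
      linarith
    have h4 : (0 : ℝ) ≤ (n : ℝ) ^ (-(1 / 2) : ℝ) := by positivity
    simp only [rateEta, lt_irrefl, if_false, if_true, sub_self, Real.rpow_zero, one_pow,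
      Finset.sum_const, Finset.card_range, nsmul_eq_mul, mul_one]
    push_cast
    calc (n : ℝ) ^ (-(1 / 2) : ℝ) * (Nat.log 2 n + 1) + 1 / 2 ^ (Nat.log 2 n + 1)
        ≤ (n : ℝ) ^ (-(1 / 2) : ℝ) * (Nat.log 2 n + 1) + (n : ℝ) ^ (-(1 / 2) : ℝ) := by
          gcongr
      _ = (n : ℝ) ^ (-(1 / 2) : ℝ) * (Nat.log 2 n + 2) := by ring
      _ ≤ (n : ℝ) ^ (-(1 / 2) : ℝ) * (3 * (Real.log (n + 1) / Real.log 2)) := by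
          gcongr; linarith
      _ = _ := by ring
  · have hβ0 : 0 < β := by linarith
    set q : ℝ := 2 ^ (β - 1) with hq
    have hq1 : 1 < q := Real.one_lt_rpow (by norm_num) (by linarith)
    refine ⟨q / (q - 1) + 1, ?_, fun n hn => ?_⟩
    · have : 0 < q - 1 := by linarith
      positivity
    have hn1 : (1 : ℝ) ≤ n := by exact_mod_cast hn
    have hn0 : (0 : ℝ) < n := by linarith
    set x : ℝ := (n : ℝ) ^ (1 / (2 * β)) with hx
    have hx1 : 1 ≤ x := Real.one_le_rpow hn1 (by positivity)
    obtain ⟨k, hk1, hk2⟩ := exists_nat_pow_near hx1 (show (1 : ℝ) < 2 by norm_num)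
    refine ⟨k + 1, by omega, ?_⟩
    have hη : rateEta β n = 1 / x := by
      rw [rateEta, if_neg (by linarith), if_neg (by linarith), Real.rpow_neg hn0.le, hx, ← one_div]
    have h1 : 1 / (2 : ℝ) ^ (k + 1) ≤ 1 / x := one_div_le_one_div_of_le (by linarith) hk2.le
    have h2 : ∑ j ∈ Finset.range (k + 1), q ^ j ≤ q / (q - 1) * x ^ (β - 1) := by
      rw [geom_sum_eq hq1.ne']
      have : q ^ k ≤ x ^ (β - 1) := by
        rw [hq, ← Real.rpow_natCast, ← Real.rpow_mul (by norm_num), mul_comm,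
          Real.rpow_mul (by norm_num), Real.rpow_natCast]
        exact Real.rpow_le_rpow (by positivity) hk1 (by linarith)
      have hq2 : 0 < q - 1 := by linarith
      rw [div_mul_eq_mul_div, div_le_div_iff_of_pos_right hq2, pow_succ]
      nlinarith
    have h3 : (n : ℝ) ^ (-(1 / 2) : ℝ) * x ^ (β - 1) = 1 / x := by
      rw [hx, ← Real.rpow_mul hn0.le, ← Real.rpow_add hn0, one_div (_ ^ _),
        ← Real.rpow_neg hn0.le]
      congr 1
      field_simp
      ring
    rw [hη]
    calc (n : ℝ) ^ (-(1 / 2) : ℝ) * ∑ j ∈ Finset.range (k + 1), q ^ j + 1 / 2 ^ (k + 1)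
        ≤ (n : ℝ) ^ (-(1 / 2) : ℝ) * (q / (q - 1) * x ^ (β - 1)) + 1 / x := by gcongr
      _ = q / (q - 1) * ((n : ℝ) ^ (-(1 / 2) : ℝ) * x ^ (β - 1)) + 1 / x := by ring
      _ = _ := by rw [h3]; ring

/-! ### Symmetrization -/

theorem rpow_lintegral_le_lintegral_rpow {X : Type*} [MeasurableSpace X] (ν : Measure X)
    [IsProbabilityMeasure ν] {f : X → ℝ≥0∞} (hf : Measurable f) {p : ℝ} (hp : 1 ≤ p) :
    (∫⁻ x, f x ∂ν) ^ p ≤ ∫⁻ x, f x ^ p ∂ν := by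
  have hp0 : 0 < p := by linarith
  have h := eLpNorm'_le_eLpNorm'_of_exponent_le one_pos hp ν hf.aestronglyMeasurable
  simp only [eLpNorm', enorm_eq_self, ENNReal.rpow_one, div_one] at h
  have h2 := ENNReal.rpow_le_rpow h hp0.le
  rwa [← ENNReal.rpow_mul, one_div_mul_cancel hp0.ne', ENNReal.rpow_one] at h2

theorem Finset.measurable_sup_enorm {X κ : Type*} [MeasurableSpace X] (T : Finset κ)
    {f : κ → X → ℝ} (hf : ∀ p, Measurable (f p)) :
    Measurable fun x => T.sup fun p => ‖f p x‖ₑ := by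
  simp_rw [Finset.sup_eq_iSup]
  exact Measurable.biSup _ T.countable_toSet fun p _ => (hf p).enorm

/-- The quadruple difference `c y q - c z q - c y m + c z m` of a pair `(y, z)` of observations,
the symmetrized increment of the cost between `m` and `q`. -/
def quadDiff {𝓨 𝓠 : Type*} (c : 𝓨 → 𝓠 → ℝ) (m : 𝓠) (z : 𝓨 × 𝓨) (q : 𝓠) : ℝ :=
  c z.1 q - c z.2 q - c z.1 m + c z.2 m

/-- Swaps the two observations of the `i`-th pair whenever `ε i` encodes the sign `-1`. -/
def signSwap {𝓨 : Type*} {n : ℕ} (ε : Fin n → Bool) (w : Fin n → 𝓨 × 𝓨) : Fin n → 𝓨 × 𝓨 :=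
  fun i => if ε i then w i else (w i).swap

theorem quadDiff_signSwap {𝓨 𝓠 : Type*} {n : ℕ} (c : 𝓨 → 𝓠 → ℝ) (m : 𝓠) (ε : Fin n → Bool)
    (w : Fin n → 𝓨 × 𝓨) (q : 𝓠) (i : Fin n) :
    quadDiff c m (signSwap ε w i) q = boolSign (ε i) * quadDiff c m (w i) q := by
  unfold signSwap boolSign quadDiff
  split_ifs
  · ring
  · simp only [Prod.fst_swap, Prod.snd_swap]; ring

theorem measurePreserving_signSwap {𝓨 : Type*} [MeasurableSpace 𝓨] (P : Measure 𝓨)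
    [IsProbabilityMeasure P] {n : ℕ} (ε : Fin n → Bool) :
    MeasurePreserving (signSwap ε) (Measure.pi fun _ : Fin n => P.prod P)
      (Measure.pi fun _ : Fin n => P.prod P) := by
  have := measurePreserving_pi (fun _ : Fin n => P.prod P) (fun _ : Fin n => P.prod P)
    (f := fun i z => if ε i then z else z.swap) (fun i => by
      by_cases h : ε i
      · simp only [h, if_true]; exact MeasurePreserving.id (P.prod P)
      · simpa [h] using Measure.measurePreserving_swap (μ := P) (ν := P))
  exact this

theorem abs_quadDiff_sub_le {𝓨 𝓠 : Type*} [PseudoMetricSpace 𝓠] {c : 𝓨 → 𝓠 → ℝ}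
    {a : 𝓨 → 𝓨 → ℝ} {m : 𝓠}
    (hquad : ∀ p q y z, c y q - c z q - c y p + c z p ≤ a y z * dist q p) (z : 𝓨 × 𝓨) (p q : 𝓠) :
    |quadDiff c m z p - quadDiff c m z q| ≤ a z.1 z.2 * dist p q := by
  have h1 := hquad q p z.1 z.2
  have h2 := hquad p q z.1 z.2
  rw [dist_comm] at h2
  unfold quadDiff
  rw [abs_le]
  constructor <;> linarith

theorem measurable_quadDiff {𝓨 𝓠 : Type*} [MeasurableSpace 𝓨] {c : 𝓨 → 𝓠 → ℝ} {m : 𝓠}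
    (hc : ∀ q, Measurable fun y => c y q) (q : 𝓠) :
    Measurable fun z => quadDiff c m z q := by
  have h1 : ∀ p, Measurable fun z : 𝓨 × 𝓨 => c z.1 p := fun p => (hc p).comp measurable_fst
  have h2 : ∀ p, Measurable fun z : 𝓨 × 𝓨 => c z.2 p := fun p => (hc p).comp measurable_snd
  exact (((h1 q).sub (h2 q)).sub (h1 m)).add (h2 m)

theorem measurable_sum_quadDiff {𝓨 𝓠 : Type*} [MeasurableSpace 𝓨] {c : 𝓨 → 𝓠 → ℝ} {m : 𝓠}
    {n : ℕ} (hc : ∀ q, Measurable fun y => c y q) (q : 𝓠) :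
    Measurable fun w : Fin n → 𝓨 × 𝓨 => ∑ i, quadDiff c m (w i) q :=
  Finset.measurable_sum _ fun i _ => (measurable_quadDiff hc q).comp (measurable_pi_apply i)

/-- The centred empirical increment `F_n(q) - F_n(m) - (F(q) - F(m))`. -/
noncomputable def empIncrement {𝓨 𝓠 : Type*} [MeasurableSpace 𝓨] {n : ℕ} (P : Measure 𝓨)
    (c : 𝓨 → 𝓠 → ℝ) (m : 𝓠) (y : Fin n → 𝓨) (q : 𝓠) : ℝ :=
  empObjective c y q - empObjective c y m - (objective P c q - objective P c m)

/-- The centred empirical increment is the mean of the symmetrized process over an independent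
copy of the sample. -/
theorem empIncrement_eq_integral {𝓨 𝓠 : Type*} [MeasurableSpace 𝓨] {P : Measure 𝓨}
    [IsProbabilityMeasure P] {c : 𝓨 → 𝓠 → ℝ} {m : 𝓠} {n : ℕ} (hn : 1 ≤ n) (hint : ∀ q, Integrable (fun y => c y q) P)
    (y : Fin n → 𝓨) (q : 𝓠) :
    n * empIncrement P c m y q =
      ∫ y', ∑ i, quadDiff c m (y i, y' i) q ∂(Measure.pi fun _ : Fin n => P) := by
  have hn0 : (n : ℝ) ≠ 0 := by exact_mod_cast (by omega : n ≠ 0)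
  have hi : ∀ q i, Integrable (fun y' : Fin n → 𝓨 => c (y' i) q) (Measure.pi fun _ => P) :=
    fun q i => integrable_comp_eval (μ := fun _ : Fin n => P) (i := i) (hint q)
  have hv : ∀ q i, ∫ y' : Fin n → 𝓨, c (y' i) q ∂(Measure.pi fun _ => P) = objective P c q :=
    fun q i => integral_comp_eval (μ := fun _ : Fin n => P) (i := i) (f := fun z => c z q)
      (hint q).aestronglyMeasurable
  have e : ∀ y' : Fin n → 𝓨, ∀ i, quadDiff c m (y i, y' i) q =
      (c (y i) q - c (y i) m) - (c (y' i) q - c (y' i) m) := fun y' i => by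
    unfold quadDiff; ring
  simp_rw [e]
  rw [integral_finsetSum Finset.univ (f := fun i (y' : Fin n → 𝓨) =>
      (c (y i) q - c (y i) m) - (c (y' i) q - c (y' i) m))
    fun i _ => (integrable_const _).sub ((hi q i).sub (hi m i))]
  have e2 : ∀ i : Fin n, ∫ y' : Fin n → 𝓨,
      ((c (y i) q - c (y i) m) - (c (y' i) q - c (y' i) m)) ∂(Measure.pi fun _ => P) =
      (c (y i) q - c (y i) m) - (objective P c q - objective P c m) := by
    intro i
    have h1 : Integrable (fun y' : Fin n → 𝓨 => c (y' i) q - c (y' i) m)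
      (Measure.pi fun _ => P) := (hi q i).sub (hi m i)
    rw [integral_sub (integrable_const _) h1, integral_sub (hi q i) (hi m i), hv, hv]
    simp
  simp_rw [e2]
  rw [Finset.sum_sub_distrib, Finset.sum_sub_distrib]
  unfold empIncrement empObjective
  simp only [Finset.sum_const, Finset.card_univ, Fintype.card_fin, nsmul_eq_mul]
  field_simp

section

variable {𝓨 𝓠 : Type*} [MeasurableSpace 𝓨] [PseudoMetricSpace 𝓠] {P : Measure 𝓨}
  {c : 𝓨 → 𝓠 → ℝ} {a : 𝓨 → 𝓨 → ℝ} {m : 𝓠} {n : ℕ} {ζ : ℝ}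
  [IsProbabilityMeasure P]

/-- Conditionally on the pairs of observations, exchanging the observations within the pairs turns
the symmetrized process into a Rademacher process, to which chaining applies. -/
theorem lintegral_sup_quadDiff_rpow_le (hζ : 1 ≤ ζ) (hc : ∀ q, Measurable fun y => c y q)
    (hquad : ∀ p q y z, c y q - c z q - c y p + c z p ≤ a y z * dist q p)
    (T : ℕ → Finset 𝓠) (hT0 : T 0 = {m}) (hT : ∀ k, (T k).Nonempty) (r : ℕ → ℝ)
    (hr : ∀ k, 0 < r k) (hnet : ∀ k, ∀ p ∈ T (k + 1), ∃ p' ∈ T k, dist p p' ≤ r k)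
    {K : ℕ} (hK : 1 ≤ K) :
    ∫⁻ w, ((T K).sup fun q => ‖∑ i, quadDiff c m (w i) q‖ₑ) ^ ζ
        ∂(Measure.pi fun _ : Fin n => P.prod P) ≤
      ENNReal.ofReal (maxConst ζ *
        (∑ k ∈ Finset.range K, r k * √(1 + Real.log (T (k + 1)).card)) ^ ζ) *
      ∫⁻ w, ENNReal.ofReal (√(∑ i, a (w i).1 (w i).2 ^ 2)) ^ ζ
        ∂(Measure.pi fun _ : Fin n => P.prod P) := by
  have hζ0 : 0 < ζ := by linarith
  set W := ∑ k ∈ Finset.range K, r k * √(1 + Real.log (T (k + 1)).card) with hW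
  have hW0 : 0 ≤ W := Finset.sum_nonneg fun k _ => mul_nonneg (hr k).le (Real.sqrt_nonneg _)
  set ν := Measure.pi fun _ : Fin n => P.prod P with hν
  set Φ : (Fin n → 𝓨 × 𝓨) → ℝ≥0∞ :=
    fun w => ((T K).sup fun q => ‖∑ i, quadDiff c m (w i) q‖ₑ) ^ ζ with hΦ
  have hΦm : Measurable Φ :=
    (Finset.measurable_sup_enorm (T K) fun q => measurable_sum_quadDiff hc q).pow_const ζ
  have hpt : ∀ w, ∑ ε : Fin n → Bool, Φ (signSwap ε w) ≤
      2 ^ n * (ENNReal.ofReal (maxConst ζ * W ^ ζ) *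
        ENNReal.ofReal (√(∑ i, a (w i).1 (w i).2 ^ 2)) ^ ζ) := by
    intro w
    have h := sum_signs_chaining_le hζ T m hT0 hT r hr hnet (fun q i => quadDiff c m (w i) q)
      (fun i => by unfold quadDiff; ring) (fun i => a (w i).1 (w i).2)
      (fun p q i => abs_quadDiff_sub_le hquad (w i) p q)
      (σ := √(∑ i, a (w i).1 (w i).2 ^ 2)) (Real.sqrt_nonneg _)
      (Real.sq_sqrt (Finset.sum_nonneg fun i _ => sq_nonneg _)).ge hK
    have hΦe : ∀ ε, Φ (signSwap ε w) = ENNReal.ofReal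
        ((((T K).sup fun p => ‖∑ i, boolSign (ε i) * quadDiff c m (w i) p‖₊ : ℝ≥0) : ℝ) ^ ζ) := by
      intro ε
      rw [← ENNReal.ofReal_rpow_of_nonneg (NNReal.coe_nonneg _) hζ0.le, ENNReal.ofReal_coe_nnreal,
        ENNReal.coe_finset_sup]
      simp only [hΦ, quadDiff_signSwap, enorm_eq_nnnorm]
    simp_rw [hΦe]
    rw [← ENNReal.ofReal_sum_of_nonneg fun ε _ => by positivity]
    refine (ENNReal.ofReal_le_ofReal h).trans_eq ?_
    rw [ENNReal.ofReal_mul (by positivity), ENNReal.ofReal_pow (by norm_num),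
      Real.mul_rpow (Real.sqrt_nonneg _) hW0,
      ENNReal.ofReal_rpow_of_nonneg (Real.sqrt_nonneg _) hζ0.le,
      ← ENNReal.ofReal_mul (mul_nonneg (maxConst_pos hζ).le (by positivity))]
    norm_num
    ring_nf
  have hswap : ∀ ε : Fin n → Bool, ∫⁻ w, Φ (signSwap ε w) ∂ν = ∫⁻ w, Φ w ∂ν := fun ε =>
    (measurePreserving_signSwap P ε).lintegral_comp hΦm
  have h2 : (2 : ℝ≥0∞) ^ n * ∫⁻ w, Φ w ∂ν ≤ 2 ^ n * (ENNReal.ofReal (maxConst ζ * W ^ ζ) *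
      ∫⁻ w, ENNReal.ofReal (√(∑ i, a (w i).1 (w i).2 ^ 2)) ^ ζ ∂ν) := by
    calc (2 : ℝ≥0∞) ^ n * ∫⁻ w, Φ w ∂ν = ∑ ε : Fin n → Bool, ∫⁻ w, Φ (signSwap ε w) ∂ν := by
          simp [hswap]
      _ = ∫⁻ w, ∑ ε : Fin n → Bool, Φ (signSwap ε w) ∂ν :=
          (lintegral_finsetSum _ fun ε _ =>
            hΦm.comp (measurePreserving_signSwap P ε).measurable).symm
      _ ≤ ∫⁻ w, 2 ^ n * (ENNReal.ofReal (maxConst ζ * W ^ ζ) *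
            ENNReal.ofReal (√(∑ i, a (w i).1 (w i).2 ^ 2)) ^ ζ) ∂ν := lintegral_mono hpt
      _ = _ := by
          rw [lintegral_const_mul' _ _ (by finiteness),
            lintegral_const_mul' _ _ ENNReal.ofReal_ne_top]
  exact (ENNReal.mul_le_mul_iff_right (by positivity) (by finiteness)).mp h2

/-- The `ζ`-th moment of the Lipschitz constant of the symmetrized process is at most
`n ^ (ζ / 2)` times the data moment. For `ζ ≥ 2` this is convexity of `x ↦ x ^ (ζ / 2)`,
for `ζ ≤ 2` it is concavity. -/
theorem lintegral_sqrt_sum_sq_rpow_le (hζ : 1 ≤ ζ) (hn : 1 ≤ n)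
    (ham : Measurable (Function.uncurry a)) (ha : ∀ y z, 0 ≤ a y z) :
    ∫⁻ w, ENNReal.ofReal (√(∑ i, a (w i).1 (w i).2 ^ 2)) ^ ζ
        ∂(Measure.pi fun _ : Fin n => P.prod P) ≤ (n : ℝ≥0∞) ^ (ζ / 2) * dataMoment P a ζ := by
  have hζ0 : 0 < ζ := by linarith
  set ν := Measure.pi fun _ : Fin n => P.prod P with hν
  set b : 𝓨 × 𝓨 → ℝ≥0∞ := fun z => ENNReal.ofReal (a z.1 z.2 ^ 2) with hb
  have hbm : Measurable b := (ham.pow_const 2).ennreal_ofReal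
  have hbi : ∀ i : Fin n, Measurable fun w : Fin n → 𝓨 × 𝓨 => b (w i) := fun i =>
    hbm.comp (measurable_pi_apply i)
  have e1 : ∀ w : Fin n → 𝓨 × 𝓨, ENNReal.ofReal (√(∑ i, a (w i).1 (w i).2 ^ 2)) ^ ζ =
      (∑ i, b (w i)) ^ (ζ / 2) := by
    intro w
    have h0 : 0 ≤ ∑ i, a (w i).1 (w i).2 ^ 2 := Finset.sum_nonneg fun i _ => sq_nonneg _
    rw [Real.sqrt_eq_rpow, ← ENNReal.ofReal_rpow_of_nonneg h0 (by norm_num), ← ENNReal.rpow_mul,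
      ENNReal.ofReal_sum_of_nonneg fun i _ => sq_nonneg _]
    congr 1; ring
  simp_rw [e1]
  have hev : ∀ (g : 𝓨 × 𝓨 → ℝ≥0∞), Measurable g → ∀ i : Fin n,
      ∫⁻ w, g (w i) ∂ν = ∫⁻ z, g z ∂(P.prod P) := fun g hg i =>
    (measurePreserving_eval (fun _ : Fin n => P.prod P) i).lintegral_comp hg
  unfold dataMoment
  split_ifs with h2
  · have hp : 1 ≤ ζ / 2 := by linarith
    have e2 : ∀ z : 𝓨 × 𝓨, ENNReal.ofReal (a z.1 z.2 ^ ζ) = b z ^ (ζ / 2) := by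
      intro z
      rw [hb]
      simp only
      rw [ENNReal.ofReal_rpow_of_nonneg (sq_nonneg _) (by linarith), ← Real.rpow_natCast,
        ← Real.rpow_mul (ha _ _)]
      congr 2; push_cast; ring
    simp_rw [e2]
    calc ∫⁻ w, (∑ i, b (w i)) ^ (ζ / 2) ∂ν
        ≤ ∫⁻ w, (n : ℝ≥0∞) ^ (ζ / 2 - 1) * ∑ i, b (w i) ^ (ζ / 2) ∂ν := by
          refine lintegral_mono fun w => ?_
          simpa using ENNReal.rpow_sum_le_const_mul_sum_rpow Finset.univ (fun i => b (w i)) hp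
      _ = (n : ℝ≥0∞) ^ (ζ / 2 - 1) * (n * ∫⁻ z, b z ^ (ζ / 2) ∂(P.prod P)) := by
          rw [lintegral_const_mul _ (Finset.measurable_sum _ fun i _ => (hbi i).pow_const _),
            lintegral_finsetSum _ fun i _ => (hbi i).pow_const _]
          congr 1
          rw [Finset.sum_congr rfl fun i _ => hev (fun z => b z ^ (ζ / 2)) (hbm.pow_const _) i]
          simp
      _ = _ := by
          have hn0 : (n : ℝ≥0∞) ≠ 0 := by exact_mod_cast (by omega : n ≠ 0)
          rw [← mul_assoc]
          congr 1
          conv_lhs => rw [← ENNReal.rpow_one (n : ℝ≥0∞), ← ENNReal.rpow_mul, one_mul]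
          rw [← ENNReal.rpow_add _ _ hn0 (ENNReal.natCast_ne_top n)]
          congr 1; ring
  · have hp : 1 ≤ 2 / ζ := by rw [le_div_iff₀ hζ0]; linarith
    have hm : Measurable fun w : Fin n → 𝓨 × 𝓨 => ∑ i, b (w i) :=
      Finset.measurable_sum _ fun i _ => hbi i
    have h3 := rpow_lintegral_le_lintegral_rpow ν (hm.pow_const (ζ / 2)) hp
    have h4 : ∀ x : ℝ≥0∞, (x ^ (ζ / 2)) ^ (2 / ζ) = x := fun x => by
      rw [← ENNReal.rpow_mul, show ζ / 2 * (2 / ζ) = 1 by field_simp, ENNReal.rpow_one]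
    have h4' : ∀ x : ℝ≥0∞, (x ^ (2 / ζ)) ^ (ζ / 2) = x := fun x => by
      rw [← ENNReal.rpow_mul, show 2 / ζ * (ζ / 2) = 1 by field_simp, ENNReal.rpow_one]
    simp_rw [h4] at h3
    rw [lintegral_finsetSum _ fun i _ => hbi i,
      Finset.sum_congr rfl fun i _ => hev b hbm i] at h3
    have h5 := ENNReal.rpow_le_rpow h3 (by linarith : 0 ≤ ζ / 2)
    rw [h4'] at h5
    refine h5.trans_eq ?_
    rw [← ENNReal.mul_rpow_of_nonneg _ _ (by linarith)]
    simp [hb]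

/-- The constant of the deviation inequality: chaining contributes `maxConst ζ`, the approximation
error of the finest net contributes `1`, and adding the two in `L^ζ` costs `2 ^ (ζ - 1)`. -/
noncomputable def devConst (ζ : ℝ) : ℝ := 2 ^ (ζ - 1) * (maxConst ζ + 1)

theorem devConst_pos {ζ : ℝ} (hζ : 1 ≤ ζ) : 0 < devConst ζ := by
  have := maxConst_pos hζ
  unfold devConst; positivity

/-- Deviation inequality for the supremum of the centred empirical increments over a set `B`:
chaining controls the finest net `T K`, and the Lipschitz bound controls the remaining
approximation error `R`. -/
theorem measure_exists_empIncrement_ge_le (hζ : 1 ≤ ζ) (hn : 1 ≤ n)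
    (hc : ∀ q, Measurable fun y => c y q) (hint : ∀ q, Integrable (fun y => c y q) P)
    (ham : Measurable (Function.uncurry a)) (ha : ∀ y z, 0 ≤ a y z)
    (hquad : ∀ p q y z, c y q - c z q - c y p + c z p ≤ a y z * dist q p)
    (T : ℕ → Finset 𝓠) (hT0 : T 0 = {m}) (hT : ∀ k, (T k).Nonempty) (r : ℕ → ℝ)
    (hr : ∀ k, 0 < r k) (hnet : ∀ k, ∀ p ∈ T (k + 1), ∃ p' ∈ T k, dist p p' ≤ r k)
    {K : ℕ} (hK : 1 ≤ K) {B : Set 𝓠} {R : ℝ} (hR : 0 ≤ R)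
    (hB : ∀ q ∈ B, ∃ p ∈ T K, dist q p ≤ R) {Θ s : ℝ} (hs : 0 < s)
    (hΘ : (n : ℝ) ^ (-(1 / 2) : ℝ) *
      ∑ k ∈ Finset.range K, r k * √(1 + Real.log (T (k + 1)).card) + R ≤ Θ) :
    (Measure.pi fun _ : Fin n => P) {y | ∃ q ∈ B, s ≤ |empIncrement P c m y q|} ≤
      ENNReal.ofReal (devConst ζ * (Θ / s) ^ ζ) * dataMoment P a ζ := by
  have hζ0 : 0 < ζ := by linarith
  have hn0 : (0 : ℝ) < n := by exact_mod_cast hn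
  set W := ∑ k ∈ Finset.range K, r k * √(1 + Real.log (T (k + 1)).card) with hW
  have hW0 : 0 ≤ W := Finset.sum_nonneg fun k _ => mul_nonneg (hr k).le (Real.sqrt_nonneg _)
  set ν := Measure.pi fun _ : Fin n => P.prod P with hν
  set Pn := Measure.pi fun _ : Fin n => P with hPn
  set S : (Fin n → 𝓨 × 𝓨) → ℝ≥0∞ :=
    fun w => (T K).sup fun q => ‖∑ i, quadDiff c m (w i) q‖ₑ with hS
  set A : (Fin n → 𝓨 × 𝓨) → ℝ := fun w => ∑ i, a (w i).1 (w i).2 with hA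
  set H : (Fin n → 𝓨 × 𝓨) → ℝ≥0∞ := fun w => S w + ENNReal.ofReal (A w * R) with hH
  have hSm : Measurable S := Finset.measurable_sup_enorm (T K) fun q => measurable_sum_quadDiff hc q
  have hAm : Measurable A := Finset.measurable_sum _ fun i _ =>
    ham.comp (measurable_pi_apply i)
  have hHm : Measurable H := hSm.add (hAm.mul_const R).ennreal_ofReal
  -- pairing a sample with an independent copy
  have hzip := (measurePreserving_arrowProdEquivProdArrow 𝓨 𝓨 (Fin n) (fun _ => P)
    (fun _ => P)).symm
  set zip := (MeasurableEquiv.arrowProdEquivProdArrow 𝓨 𝓨 (Fin n)).symm with hzipdef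
  have hzipap : ∀ y y' : Fin n → 𝓨, zip (y, y') = fun i => (y i, y' i) := fun y y' => rfl
  have hHzm : Measurable fun p : (Fin n → 𝓨) × (Fin n → 𝓨) => H (zip p) := hHm.comp zip.measurable
  -- pointwise domination, simultaneously for all `q ∈ B`
  have hdom : ∀ y, ∀ q ∈ B, ENNReal.ofReal (n * |empIncrement P c m y q|) ≤
      ∫⁻ y', H (zip (y, y')) ∂Pn := by
    intro y q hq
    have habs : n * |empIncrement P c m y q| = |n * empIncrement P c m y q| := by
      rw [abs_mul, abs_of_pos hn0]
    rw [habs, empIncrement_eq_integral hn hint, ← Real.enorm_eq_ofReal_abs]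
    refine (enorm_integral_le_lintegral_enorm _).trans (lintegral_mono fun y' => ?_)
    obtain ⟨p, hp, hqp⟩ := hB q hq
    rw [hzipap]
    set w : Fin n → 𝓨 × 𝓨 := fun i => (y i, y' i) with hw
    change ‖∑ i, quadDiff c m (w i) q‖ₑ ≤ _
    have e : ∑ i, quadDiff c m (w i) q = ∑ i, quadDiff c m (w i) p +
        ∑ i, (quadDiff c m (w i) q - quadDiff c m (w i) p) := by
      rw [← Finset.sum_add_distrib]; exact Finset.sum_congr rfl fun i _ => by ring
    rw [e]
    refine (enorm_add_le _ _).trans (add_le_add ?_ ?_)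
    · exact Finset.le_sup (f := fun q => ‖∑ i, quadDiff c m (w i) q‖ₑ) hp
    · rw [Real.enorm_eq_ofReal_abs]
      refine ENNReal.ofReal_le_ofReal ((Finset.abs_sum_le_sum_abs _ _).trans ?_)
      rw [hA, Finset.sum_mul]
      refine Finset.sum_le_sum fun i _ => (abs_quadDiff_sub_le hquad (w i) q p).trans ?_
      exact mul_le_mul_of_nonneg_left hqp (ha _ _)
  set N : ℝ≥0∞ := (n : ℝ≥0∞) ^ (ζ / 2) with hN
  have hNr : N = ENNReal.ofReal ((n : ℝ) ^ (ζ / 2)) := by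
    rw [hN, ← ENNReal.ofReal_natCast, ENNReal.ofReal_rpow_of_nonneg hn0.le (by linarith)]
  set M := dataMoment P a ζ with hM
  have hmom := lintegral_sqrt_sum_sq_rpow_le (P := P) hζ hn ham ha
  have hHbound : ∫⁻ w, H w ^ ζ ∂ν ≤
      ENNReal.ofReal (devConst ζ * (n * Θ) ^ ζ) * M := by
    have hS1 := (lintegral_sup_quadDiff_rpow_le (P := P) (n := n) hζ hc hquad T hT0 hT r hr hnet
      hK).trans (mul_le_mul_right hmom _)
    have hA1 : ∀ w, ENNReal.ofReal (A w * R) ^ ζ ≤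
        ENNReal.ofReal ((√n * R) ^ ζ) * ENNReal.ofReal (√(∑ i, a (w i).1 (w i).2 ^ 2)) ^ ζ := by
      intro w
      rw [← ENNReal.ofReal_rpow_of_nonneg (by positivity) hζ0.le,
        ← ENNReal.mul_rpow_of_nonneg _ _ hζ0.le, ← ENNReal.ofReal_mul (by positivity)]
      refine ENNReal.rpow_le_rpow (ENNReal.ofReal_le_ofReal ?_) hζ0.le
      have : A w ≤ √n * √(∑ i, a (w i).1 (w i).2 ^ 2) := by
        rw [← Real.sqrt_mul hn0.le]
        refine Real.le_sqrt_of_sq_le ?_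
        simpa using sq_sum_le_card_mul_sum_sq (s := Finset.univ)
          (f := fun i : Fin n => a (w i).1 (w i).2)
      nlinarith
    have hA2 : ∫⁻ w, ENNReal.ofReal (A w * R) ^ ζ ∂ν ≤
        ENNReal.ofReal ((√n * R) ^ ζ) * (N * M) := by
      refine (lintegral_mono hA1).trans ?_
      rw [lintegral_const_mul' _ _ ENNReal.ofReal_ne_top]
      exact mul_le_mul_right hmom _
    have htwo : (2 : ℝ≥0∞) ^ (ζ - 1) = ENNReal.ofReal (2 ^ (ζ - 1)) := by
      rw [← ENNReal.ofReal_rpow_of_nonneg (by norm_num) (by linarith)]; norm_num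
    calc ∫⁻ w, H w ^ ζ ∂ν
        ≤ ∫⁻ w, 2 ^ (ζ - 1) * (S w ^ ζ + ENNReal.ofReal (A w * R) ^ ζ) ∂ν :=
          lintegral_mono fun w => ENNReal.rpow_add_le_mul_rpow_add_rpow _ _ hζ
      _ = 2 ^ (ζ - 1) * (∫⁻ w, S w ^ ζ ∂ν + ∫⁻ w, ENNReal.ofReal (A w * R) ^ ζ ∂ν) := by
          rw [lintegral_const_mul' _ _ (by rw [htwo]; exact ENNReal.ofReal_ne_top),
            lintegral_add_left (hSm.pow_const ζ)]
      _ ≤ 2 ^ (ζ - 1) * (ENNReal.ofReal (maxConst ζ * W ^ ζ) * (N * M) +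
            ENNReal.ofReal ((√n * R) ^ ζ) * (N * M)) := by gcongr
      _ = ENNReal.ofReal (2 ^ (ζ - 1) * ((maxConst ζ * W ^ ζ + (√n * R) ^ ζ) *
            (n : ℝ) ^ (ζ / 2))) * M := by
          have hm0 := (maxConst_pos hζ).le
          have hs1 : 0 ≤ maxConst ζ * W ^ ζ := by positivity
          have hs2 : 0 ≤ (√n * R) ^ ζ := by positivity
          rw [ENNReal.ofReal_mul (p := 2 ^ (ζ - 1)) (by positivity),
            ENNReal.ofReal_mul (add_nonneg hs1 hs2), ENNReal.ofReal_add hs1 hs2, htwo, hNr]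
          ring
      _ ≤ _ := by
          refine mul_le_mul_left (ENNReal.ofReal_le_ofReal ?_) _
          have hm0 := (maxConst_pos hζ).le
          have hnn : (n : ℝ) ^ (ζ / 2) = (√n) ^ ζ := by
            rw [Real.sqrt_eq_rpow, ← Real.rpow_mul hn0.le]; congr 1; ring
          have hsn : (n : ℝ) ^ (-(1 / 2) : ℝ) = 1 / √n := by
            rw [Real.rpow_neg hn0.le, ← Real.sqrt_eq_rpow, one_div]
          have hsq : √(n : ℝ) * √n = n := Real.mul_self_sqrt hn0.le
          have hsp : 0 < √(n : ℝ) := Real.sqrt_pos.mpr hn0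
          rw [hsn] at hΘ
          have hΘ1 : W ≤ √n * Θ := by
            have : 1 / √n * W ≤ Θ := by linarith
            rw [one_div_mul_eq_div, div_le_iff₀ hsp] at this
            linarith
          have hΘ2 : R ≤ Θ := by
            have : 0 ≤ 1 / √n * W := by positivity
            linarith
          have hΘ0 : 0 ≤ Θ := hR.trans hΘ2
          have b1 : W ^ ζ ≤ (√n * Θ) ^ ζ := Real.rpow_le_rpow hW0 hΘ1 hζ0.le
          have b2 : (√n * R) ^ ζ ≤ (√n * Θ) ^ ζ := by gcongr
          have e3 : (n * Θ) ^ ζ = (√n * Θ) ^ ζ * (n : ℝ) ^ (ζ / 2) := by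
            rw [hnn, ← Real.mul_rpow (by positivity) (by positivity)]
            congr 1; linear_combination (-Θ) * hsq
          rw [e3, devConst, mul_assoc]
          refine mul_le_mul_of_nonneg_left ?_ (by positivity)
          rw [← mul_assoc]
          refine mul_le_mul_of_nonneg_right ?_ (by positivity)
          nlinarith
  have hexp : ∫⁻ y, (∫⁻ y', H (zip (y, y')) ∂Pn) ^ ζ ∂Pn ≤
      ENNReal.ofReal (devConst ζ * (n * Θ) ^ ζ) * M := by
    refine le_trans ?_ hHbound
    calc ∫⁻ y, (∫⁻ y', H (zip (y, y')) ∂Pn) ^ ζ ∂Pn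
        ≤ ∫⁻ y, ∫⁻ y', H (zip (y, y')) ^ ζ ∂Pn ∂Pn := lintegral_mono fun y =>
          rpow_lintegral_le_lintegral_rpow Pn (hHzm.comp measurable_prodMk_left) hζ
      _ = ∫⁻ p, H (zip p) ^ ζ ∂(Pn.prod Pn) :=
          (lintegral_prod _ (hHzm.pow_const ζ).aemeasurable).symm
      _ = ∫⁻ w, H w ^ ζ ∂ν := hzip.lintegral_comp (hHm.pow_const ζ)
  have hΘ0 : 0 ≤ Θ := by
    have : 0 ≤ (n : ℝ) ^ (-(1 / 2) : ℝ) * W := by positivity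
    linarith
  have hsub : {y : Fin n → 𝓨 | ∃ q ∈ B, s ≤ |empIncrement P c m y q|} ⊆
      {y | ENNReal.ofReal ((n * s) ^ ζ) ≤ (∫⁻ y', H (zip (y, y')) ∂Pn) ^ ζ} := by
    rintro y ⟨q, hq, hsq⟩
    change ENNReal.ofReal ((n * s) ^ ζ) ≤ _
    rw [← ENNReal.ofReal_rpow_of_nonneg (by positivity) hζ0.le]
    refine ENNReal.rpow_le_rpow (le_trans (ENNReal.ofReal_le_ofReal ?_) (hdom y q hq)) hζ0.le
    gcongr
  have hmark := mul_meas_ge_le_lintegral (μ := Pn)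
    ((hHzm.lintegral_prod_right' (ν := Pn)).pow_const ζ) (ENNReal.ofReal ((n * s) ^ ζ))
  have hpos : 0 < (n * s) ^ ζ := by positivity
  have h1 : ENNReal.ofReal ((n * s) ^ ζ) * Pn {y | ∃ q ∈ B, s ≤ |empIncrement P c m y q|} ≤
      ENNReal.ofReal ((n * s) ^ ζ) * (ENNReal.ofReal (devConst ζ * (Θ / s) ^ ζ) * M) := by
    refine ((mul_le_mul_right (measure_mono hsub) _).trans hmark).trans (hexp.trans_eq ?_)
    rw [← mul_assoc, ← ENNReal.ofReal_mul hpos.le]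
    congr 2
    rw [Real.div_rpow hΘ0 hs.le, Real.mul_rpow hn0.le hΘ0, Real.mul_rpow hn0.le hs.le]
    have : s ^ ζ ≠ 0 := by positivity
    field_simp
  exact (ENNReal.mul_le_mul_iff_right (by simpa using hpos)
    ENNReal.ofReal_ne_top).mp h1

end

/-! ### Localization and peeling -/

/-- Deviation inequality on a single ball of the loss: the modulus of continuity of the centred
empirical process over `B_δ(m)` is of order `η * δ ^ (α / β)`. -/
theorem exists_measure_lossBall_le {α β ce ζ : ℝ} (hβ : 0 < β) (hce : 0 < ce) (hζ : 1 ≤ ζ) :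
    ∃ C : ℝ, 0 < C ∧
      ∀ (𝓨 : Type*) [MeasurableSpace 𝓨] (P : Measure 𝓨) [IsProbabilityMeasure P]
        (𝓠 : Type*) [PseudoMetricSpace 𝓠] (c : 𝓨 → 𝓠 → ℝ) (l : 𝓠 → 𝓠 → ℝ) (a : 𝓨 → 𝓨 → ℝ)
        (m : 𝓠) (n : ℕ),
        (∀ q, Measurable fun y => c y q) → 1 ≤ n → (∀ q, Integrable (fun y => c y q) P) →
        l m m = 0 → Measurable (Function.uncurry a) → (∀ y z, 0 ≤ a y z) →
        (∀ p q y z, c y q - c z q - c y p + c z p ≤ a y z * dist q p) →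
        ∀ δ s : ℝ, 0 < δ → 0 < s →
        (∀ r : ℝ≥0, 0 < r →
          Metric.externalCoveringNumber r (lossBall l m δ) ≠ ⊤ ∧
          √(Real.log (Metric.externalCoveringNumber r (lossBall l m δ)).toNat) ≤
            ce * (δ ^ α / (r : ℝ) ^ β)) →
        (Measure.pi fun _ : Fin n => P)
            {y | ∃ q ∈ lossBall l m δ, s ≤ |empIncrement P c m y q|} ≤
          ENNReal.ofReal (devConst ζ * (C * rateEta β n * δ ^ (α / β) / s) ^ ζ) *
            dataMoment P a ζ := by
  obtain ⟨C, hC, hdepth⟩ := exists_depth β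
  set ρ : ℝ := (2 * ce) ^ (1 / β) with hρ
  have hρ0 : 0 < ρ := by positivity
  have hρβ : ρ ^ β = 2 * ce := by
    rw [hρ, ← Real.rpow_mul (by positivity), one_div_mul_cancel hβ.ne', Real.rpow_one]
  refine ⟨2 * ρ * (1 + 2 ^ β) * C, by positivity, ?_⟩
  intro 𝓨 _ P _ 𝓠 _ c l a m n hc hn hint hlm ham ha hquad δ s hδ hs hent
  set D : ℝ := δ ^ (α / β) with hD
  have hD0 : 0 < D := by positivity
  have hm : m ∈ lossBall l m δ := by
    change l m m ≤ δ
    rw [hlm]; exact hδ.le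
  obtain ⟨T, hT0, hTne, hTB, hTcov, hTcard⟩ := exists_nets hm hD0 hρ0 hρβ hce (fun r hr => by
    refine ⟨(hent r hr).1, (hent r hr).2.trans_eq ?_⟩
    rw [Real.div_rpow hD0.le r.coe_nonneg, hD, ← Real.rpow_mul hδ.le, div_mul_cancel₀ _ hβ.ne'])
  obtain ⟨K, hK, hKη⟩ := hdepth n hn
  have hcard1 : ∀ k, (1 : ℝ) ≤ (T k).card := fun k => by exact_mod_cast (hTne k).card_pos
  have hW := sum_chaining_weights_le (R := 2 * ρ * D) (by positivity) hβ
    (fun k => ((T k).card : ℝ)) hcard1 hTcard K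
  refine measure_exists_empIncrement_ge_le hζ hn hc hint ham ha hquad T hT0 hTne
    (fun k => 2 * ρ * D / 2 ^ k) (fun k => by positivity)
    (fun k p hp => hTcov k p (hTB (k + 1) hp)) hK (R := 2 * ρ * D / 2 ^ K) (by positivity)
    (hTcov K) hs ?_
  have h2 : (0 : ℝ) < 2 ^ β := by positivity
  calc (n : ℝ) ^ (-(1 / 2) : ℝ) * ∑ k ∈ Finset.range K,
          2 * ρ * D / 2 ^ k * √(1 + Real.log (T (k + 1)).card) + 2 * ρ * D / 2 ^ K
      ≤ (n : ℝ) ^ (-(1 / 2) : ℝ) * (2 * ρ * D * (1 + 2 ^ β) *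
          ∑ k ∈ Finset.range K, ((2 : ℝ) ^ (β - 1)) ^ k) +
          2 * ρ * D * (1 + 2 ^ β) * (1 / 2 ^ K) := by
        have : 2 * ρ * D / 2 ^ K ≤ 2 * ρ * D * (1 + 2 ^ β) * (1 / 2 ^ K) := by
          rw [mul_one_div]
          refine div_le_div_of_nonneg_right ?_ (by positivity)
          exact le_mul_of_one_le_right (by positivity) (by linarith)
        gcongr
    _ = 2 * ρ * D * (1 + 2 ^ β) * ((n : ℝ) ^ (-(1 / 2) : ℝ) *
          ∑ k ∈ Finset.range K, ((2 : ℝ) ^ (β - 1)) ^ k + 1 / 2 ^ K) := by ring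
    _ ≤ 2 * ρ * D * (1 + 2 ^ β) * (C * rateEta β n) := by gcongr
    _ = _ := by ring

/-- The basic inequality: at a minimizer `q` of the empirical objective, the growth of the
objective is bounded by the centred empirical increment. -/
theorem le_abs_empIncrement_of_mem_argminSet {𝓨 𝓠 : Type*} [MeasurableSpace 𝓨] {P : Measure 𝓨}
    {c : 𝓨 → 𝓠 → ℝ} {m q : 𝓠} {n : ℕ} {y : Fin n → 𝓨} {s : ℝ}
    (hq : q ∈ argminSet (empObjective c y)) (hs : s ≤ objective P c q - objective P c m) :
    s ≤ |empIncrement P c m y q| := by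
  refine le_trans ?_ (neg_le_abs _)
  have := hq m
  unfold empIncrement
  linarith

/-- The deviation bound on the `j`-th dyadic shell decays geometrically in `j`. -/
theorem shell_ratio_eq {α β γ κ C cg η t : ℝ} (hη : 0 < η) (ht : 0 < t) (hκ : 0 < κ)
    (hκd : κ = γ - α / β) (hcg : 0 < cg) (j : ℕ) :
    C * η * (2 ^ (j + 1) * (t * η ^ (1 / κ))) ^ (α / β) /
        (cg * (2 ^ j * (t * η ^ (1 / κ))) ^ γ) =
      C * 2 ^ (α / β) / cg * t ^ (-κ) * (2 ^ (-κ)) ^ j := by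
  set τ := t * η ^ (1 / κ) with hτ
  have hτ0 : 0 < τ := by positivity
  have h1 : τ ^ κ = t ^ κ * η := by
    rw [hτ, Real.mul_rpow ht.le (by positivity), ← Real.rpow_mul hη.le,
      one_div_mul_cancel hκ.ne', Real.rpow_one]
  set x : ℝ := 2 ^ j * τ with hx
  have hx0 : 0 < x := by positivity
  have h2 : (2 : ℝ) ^ (j + 1) * τ = 2 * x := by rw [hx]; ring
  have h3 : x ^ γ = x ^ (α / β) * x ^ κ := by
    rw [← Real.rpow_add hx0]; congr 1; rw [hκd]; ring
  have h4 : x ^ κ = (2 ^ κ) ^ j * (t ^ κ * η) := by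
    rw [hx, Real.mul_rpow (by positivity) hτ0.le, h1, ← Real.rpow_natCast, ← Real.rpow_mul
      (by norm_num), ← Real.rpow_natCast, ← Real.rpow_mul (by norm_num), mul_comm κ]
  rw [h2, Real.mul_rpow (by norm_num) hx0.le, h3, h4, Real.rpow_neg ht.le,
    Real.rpow_neg (by norm_num), inv_pow]
  have : x ^ (α / β) ≠ 0 := by positivity
  field_simp

/-- The descriptor metric `b` is the distance `dist` of the pseudo-metric space `𝓠`. The covering
number is finite and `√(log N) ≤ ce δ^α / r^β`. The constant `C` is chosen before all spaces,
the law, the cost, the loss, `a`, `b`, the sample size and `t`. -/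
theorem theorem1 (α β γ ce cg ζ : ℝ) (hα : 0 < α) (hβ : 0 < β) (hγ : 0 < γ) (hce : 0 < ce)
    (hcg : 0 < cg) (hζ : 1 ≤ ζ) (hαβ : α / β < γ) :
    ∃ C : ℝ, 0 < C ∧
      ∀ (Ω : Type*) [MeasurableSpace Ω] (μ : Measure Ω) [IsProbabilityMeasure μ]
        (𝓨 : Type*) [MeasurableSpace 𝓨] (P : Measure 𝓨) [IsProbabilityMeasure P]
        (𝓠 : Type*) [PseudoMetricSpace 𝓠]
        (c : 𝓨 → 𝓠 → ℝ) (l : 𝓠 → 𝓠 → ℝ) (a : 𝓨 → 𝓨 → ℝ) (m : 𝓠)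
        (n : ℕ) (Y : Fin n → Ω → 𝓨) (mn : Ω → 𝓠),
        -- the setting: measurable cost, nonnegative loss, i.i.d. sample of law `P`, `n ≥ 1`
        (∀ q, Measurable fun y => c y q) →
        (∀ p q, 0 ≤ l p q) →
        1 ≤ n →
        (∀ i, HasLaw (Y i) P μ) →
        iIndepFun Y μ →
        -- Existence
        (∀ q, Integrable (fun y => c y q) P) →
        m ∈ argminSet (objective P c) →
        (∀ᵐ ω ∂μ, mn ω ∈ argminSet (empObjective c fun i => Y i ω)) →
        -- Growth
        (∀ q, cg * l m q ^ γ ≤ objective P c q - objective P c m) →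
        -- Weak Quadruple
        Measurable (Function.uncurry a) →
        (∀ y z, 0 ≤ a y z) →
        (∀ p q y z, c y q - c z q - c y p + c z p ≤ a y z * dist q p) →
        -- Moment
        dataMoment P a ζ < ∞ →
        -- Entropy
        (∀ δ : ℝ, 0 < δ → ∀ r : ℝ≥0, 0 < r →
          Metric.externalCoveringNumber r (lossBall l m δ) ≠ ⊤ ∧
          √(Real.log (Metric.externalCoveringNumber r (lossBall l m δ)).toNat) ≤
            ce * (δ ^ α / (r : ℝ) ^ β)) →
        -- Conclusion
        ∀ t : ℝ, 0 < t →
          μ.real {ω | t ≤ rateEta β n ^ (-(1 / (γ - α / β))) * l m (mn ω)} ≤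
            C * (dataMoment P a ζ).toReal * t ^ (-(ζ * (γ - α / β))) := by
  obtain ⟨C, hC, hdev⟩ := exists_measure_lossBall_le (α := α) hβ hce hζ
  have hζ0 : 0 < ζ := by linarith
  set κ := γ - α / β with hκ
  have hκ0 : 0 < κ := by rw [hκ]; linarith
  set C₂ : ℝ := C * 2 ^ (α / β) / cg with hC₂
  set θ : ℝ := (2 ^ (-κ)) ^ ζ with hθ
  have hθ0 : 0 < θ := by positivity
  have hθ1 : θ < 1 := Real.rpow_lt_one (by positivity)
    (Real.rpow_lt_one_of_one_lt_of_neg (by norm_num) (by linarith)) hζ0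
  have hθ2 : 0 < 1 - θ := by linarith
  have hdc := devConst_pos hζ
  -- summing the shell bounds gives a geometric series of ratio `θ = 2 ^ (-κ * ζ) < 1`
  refine ⟨devConst ζ * C₂ ^ ζ * (1 - θ)⁻¹, by positivity, ?_⟩
  intro Ω _ μ _ 𝓨 _ P _ 𝓠 _ c l a m n Y mn hc hl hn hlaw hindep hint hm hmn hgrow ham ha hquad
    hmom hent t ht
  set η := rateEta β n with hη
  have hη0 : 0 < η := rateEta_pos β hn
  set τ := t * η ^ (1 / κ) with hτ
  have hτ0 : 0 < τ := by positivity
  set M := dataMoment P a ζ with hM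
  have hlm : l m m = 0 := by
    have h1 := hgrow m
    rw [sub_self] at h1
    by_contra h2
    have : 0 < l m m := lt_of_le_of_ne (hl m m) (Ne.symm h2)
    have : 0 < cg * l m m ^ γ := by positivity
    linarith
  have hYm : AEMeasurable (fun ω i => Y i ω) μ :=
    aemeasurable_pi_lambda _ fun i => (hlaw i).aemeasurable
  have hYlaw : μ.map (fun ω i => Y i ω) = Measure.pi fun _ : Fin n => P := by
    rw [(iIndepFun_iff_map_fun_eq_pi_map fun i => (hlaw i).aemeasurable).mp hindep]
    congr 1; funext i; exact (hlaw i).map_eq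
  set E : ℕ → Set (Fin n → 𝓨) := fun j =>
    {y | ∃ q ∈ lossBall l m (2 ^ (j + 1) * τ), cg * (2 ^ j * τ) ^ γ ≤ |empIncrement P c m y q|}
    with hE
  have hEle : ∀ j, μ ((fun ω i => Y i ω) ⁻¹' E j) ≤
      ENNReal.ofReal (devConst ζ * C₂ ^ ζ * t ^ (-(ζ * κ)) * θ ^ j) * M := by
    intro j
    -- valid for the possibly non-measurable set `E j`
    refine (Measure.le_map_apply hYm _).trans ?_
    rw [hYlaw]
    refine (hdev 𝓨 P 𝓠 c l a m n hc hn hint hlm ham ha hquad (2 ^ (j + 1) * τ)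
      (cg * (2 ^ j * τ) ^ γ) (by positivity) (by positivity)
      (hent _ (by positivity))).trans_eq ?_
    rw [← hη, hτ, shell_ratio_eq hη0 ht hκ0 hκ hcg j, ← hC₂, Real.mul_rpow (by positivity)
      (by positivity), Real.mul_rpow (by positivity) (by positivity), ← Real.rpow_mul ht.le,
      ← Real.rpow_natCast (2 ^ (-κ)) j, ← Real.rpow_mul (by positivity) _ ζ, mul_comm (j : ℝ) ζ,
      Real.rpow_mul (by positivity) ζ, ← hθ, Real.rpow_natCast]
    congr 2
    rw [show -κ * ζ = -(ζ * κ) by ring]; ring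
  have hcover : {ω | t ≤ η ^ (-(1 / κ)) * l m (mn ω)} ⊆
      {ω | ¬ mn ω ∈ argminSet (empObjective c fun i => Y i ω)} ∪
        ⋃ j, (fun ω i => Y i ω) ⁻¹' E j := by
    intro ω hω
    by_cases harg : mn ω ∈ argminSet (empObjective c fun i => Y i ω)
    · -- `j` indexes the dyadic shell `2 ^ j * τ ≤ l m (mn ω) < 2 ^ (j + 1) * τ`
      refine Or.inr (Set.mem_iUnion.mpr ?_)
      have hω' : t ≤ η ^ (-(1 / κ)) * l m (mn ω) := hω
      have hτl : τ ≤ l m (mn ω) := by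
        rw [Real.rpow_neg hη0.le, inv_mul_eq_div, le_div_iff₀ (by positivity)] at hω'
        exact hω'
      obtain ⟨j, hj1, hj2⟩ := exists_nat_pow_near ((one_le_div hτ0).mpr hτl)
        (show (1 : ℝ) < 2 by norm_num)
      rw [le_div_iff₀ hτ0] at hj1
      rw [div_lt_iff₀ hτ0] at hj2
      refine ⟨j, mn ω, hj2.le, ?_⟩
      refine le_abs_empIncrement_of_mem_argminSet harg (le_trans ?_ (hgrow (mn ω)))
      gcongr
    · exact Or.inl harg
  have hsum : Summable fun j : ℕ => devConst ζ * C₂ ^ ζ * t ^ (-(ζ * κ)) * θ ^ j :=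
    (summable_geometric_of_lt_one hθ0.le hθ1).mul_left _
  have hμ : μ {ω | t ≤ η ^ (-(1 / κ)) * l m (mn ω)} ≤
      ENNReal.ofReal (devConst ζ * C₂ ^ ζ * t ^ (-(ζ * κ)) * (1 - θ)⁻¹) * M := by
    calc μ {ω | t ≤ η ^ (-(1 / κ)) * l m (mn ω)}
        ≤ 0 + ∑' j, μ ((fun ω i => Y i ω) ⁻¹' E j) := by
          refine (measure_mono hcover).trans ((measure_union_le _ _).trans
            (add_le_add (le_of_eq ?_) (measure_iUnion_le _)))
          exact hmn
      _ ≤ ∑' j : ℕ, ENNReal.ofReal (devConst ζ * C₂ ^ ζ * t ^ (-(ζ * κ)) * θ ^ j) * M := by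
          rw [zero_add]; exact ENNReal.tsum_le_tsum hEle
      _ = _ := by
          rw [ENNReal.tsum_mul_right, ← ENNReal.ofReal_tsum_of_nonneg
            (fun j => by positivity) hsum, tsum_mul_left, tsum_geometric_of_lt_one hθ0.le hθ1]
  have hfin := ENNReal.toReal_mono (ENNReal.mul_ne_top ENNReal.ofReal_ne_top hmom.ne) hμ
  rw [ENNReal.toReal_mul, ENNReal.toReal_ofReal (by positivity)] at hfin
  refine hfin.trans_eq ?_
  ring
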